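/- Let $n,m\ge 0$ be integers, let $W=(W_1(t),\dots,W_n(t))_{t\ge 0}$ be a standard $n$-dimensional Brownian motion (started at $0$) on a probability space $(\Omega,\mathcal F,P)$, and let $(\mathcal F_t)_{t\ge 0}$ be a filtration to which $W$ is adapted (for instance, the filtration generated by $W$, or a filtration satisfying the usual conditions of right-continuity and completeness for which $W$ is a Brownian motion). For $1\le i\le j\le n$ put $$W_t^{ij}=\Big(W_1(t),\dots,W_{i-1}(t),\ \frac{W_i(t)+W_j(t)}{\sqrt2},\ W_{i+1}(t),\dots,W_n(t)\Big),$$ so that, in particular, $W^{ii}$ is $W$ with its $i$-th coordinate multiplied by $\sqrt2$. Let $f:\mathbb R^n\to\mathbb R^m$ be a (Lebesgue) measurable function such that for all $1\le i\le j\le n$ the process $(f(W_t^{ij}))_{t\ge 0}$ is a martingale with respect to $(\mathcal F_t)$. Then $f$ coincides with an affine function almost everywhere with respect to the Lebesgue measure on $\mathbb R^n$: there is an affine map $g:\mathbb R^n\to\mathbb R^m$ with $f(x)=g(x)$ for Lebesgue-almost every $x\in\mathbb R^n$. -/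

import Mathlib

open MeasureTheory ProbabilityTheory
open scoped NNReal

/-- `W` is a standard `n`-dimensional Brownian motion under `P`: it starts at the origin almost
surely, its increments over disjoint intervals are independent, `W t - W s` is centred Gaussian
with covariance `(t - s)` times the identity, and almost all its paths are continuous. -/
structure IsStandardBrownianMotion {Ω : Type*} [MeasurableSpace Ω] {n : ℕ}
    (W : ℝ≥0 → Ω → EuclideanSpace ℝ (Fin n)) (P : Measure Ω) : Prop where
  start : ∀ᵐ ω ∂P, W 0 ω = 0
  indep_increments : HasIndepIncrements W P
  law_increments : ∀ s t : ℝ≥0, s ≤ t →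
    HasLaw (fun ω => W t ω - W s ω)
      (multivariateGaussian 0 (((t : ℝ) - (s : ℝ)) • (1 : Matrix (Fin n) (Fin n) ℝ))) P
  continuous_paths : ∀ᵐ ω ∂P, Continuous fun t => W t ω

/-- The vector `x` with its `i`-th coordinate replaced by `(x i + x j) / √2`. -/
noncomputable def mixCoord {n : ℕ} (i j : Fin n) (x : EuclideanSpace ℝ (Fin n)) :
    EuclideanSpace ℝ (Fin n) :=
  WithLp.toLp 2 (Function.update (fun k => x k) i ((x i + x j) / √2))

/-! Write `A` for the linear automorphism `mixCoordEquiv i j`. Independence of `W 1` and `W (1 + h)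
- W 1`, with the martingale identity tested on events `{W 1 ∈ B}`, gives `E f(x + √h A Z) = f x` for
almost every `x`, where `Z` is standard Gaussian (`ae_eq_integral_of_martingale`). Adaptedness alone
suffices: increments need not be independent of the filtration.

Integrability at all times makes `f` integrable against every `exp (-c‖x‖²)`, so `f` can be
mollified. By Fubini the smooth `u = φ ⋆ f` has the same invariance at every point, and letting `h →
0` in symmetric second differences yields `E D²u(x)(AZ, AZ) = 0`, that is `tr (Aᵀ D²u(x) A) = 0`
(`integral_hessian_convolution_eq_zero`).

For `i = j` this reads `Δu + ∂ᵢᵢu = 0`; summing over `i` gives `(n + 1) Δu = 0`, so every `∂ᵢᵢu`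
vanishes. For `i < j` it reads `Δu + √2 ∂ᵢⱼu = 0`, so the whole Hessian is zero
(`eq_zero_of_sum_mixCoord_eq_zero`) and `u` is affine. The mollifications converge to `f` almost
everywhere, and an almost everywhere limit of affine maps is almost everywhere affine
(`exists_affineMap_ae_eq_of_ae_tendsto`). -/

/-! ### Isotropic Gaussian laws and their densities. -/

section GaussianDensity

open scoped RealInnerProductSpace

lemma posSemidef_smul_one {ι : Type*} [DecidableEq ι] {t : ℝ} (ht : 0 ≤ t) :
    (t • (1 : Matrix ι ι ℝ)).PosSemidef :=
  Matrix.PosSemidef.one.smul ht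

variable {ι : Type*} [Fintype ι]

lemma charFun_multivariateGaussian_smul_one [DecidableEq ι] {t : ℝ} (ht : 0 ≤ t)
    (x : EuclideanSpace ℝ ι) :
    charFun (multivariateGaussian 0 (t • (1 : Matrix ι ι ℝ))) x
      = Complex.exp (-(t * ‖x‖ ^ 2 / 2)) := by
  rw [charFun_multivariateGaussian (posSemidef_smul_one ht)]
  have : x.ofLp ⬝ᵥ (t • (1 : Matrix ι ι ℝ)).mulVec x.ofLp = t * ‖x‖ ^ 2 := by
    rw [Matrix.smul_mulVec, Matrix.one_mulVec, EuclideanSpace.real_norm_sq_eq]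
    simp [dotProduct, Finset.mul_sum, sq, mul_left_comm]
  rw [this]
  congr 1
  simp

lemma multivariateGaussian_smul_one_eq_map [DecidableEq ι] {t : ℝ} (ht : 0 ≤ t) :
    multivariateGaussian 0 (t • (1 : Matrix ι ι ℝ))
      = (stdGaussian (EuclideanSpace ℝ ι)).map (fun x => √t • x) := by
  have : IsProbabilityMeasure ((stdGaussian (EuclideanSpace ℝ ι)).map (fun x => √t • x)) :=
    Measure.isProbabilityMeasure_map (by fun_prop)
  apply Measure.ext_of_charFun
  ext x
  rw [charFun_multivariateGaussian_smul_one ht, charFun_map_smul, charFun_stdGaussian, norm_smul,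
    ← Complex.ofReal_pow (‖√t‖ * ‖x‖), mul_pow, Real.norm_of_nonneg (Real.sqrt_nonneg t),
    Real.sq_sqrt ht]
  push_cast
  congr 1
  ring

/-- The density of the centred Gaussian law on `EuclideanSpace ℝ ι` with covariance `t • 1`. -/
noncomputable def gaussianDensity (t : ℝ) (x : EuclideanSpace ℝ ι) : ℝ :=
  ((Real.pi / (2 * t)⁻¹) ^ ((Fintype.card ι : ℝ) / 2))⁻¹ * Real.exp (-(2 * t)⁻¹ * ‖x‖ ^ 2)

lemma gaussianDensity_pos {t : ℝ} (ht : 0 < t) (x : EuclideanSpace ℝ ι) :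
    0 < gaussianDensity t x := by
  unfold gaussianDensity; positivity

@[fun_prop]
lemma measurable_gaussianDensity (t : ℝ) :
    Measurable (gaussianDensity t : EuclideanSpace ℝ ι → ℝ) := by
  unfold gaussianDensity; fun_prop

lemma integrable_gaussianDensity {t : ℝ} (ht : 0 < t) :
    Integrable (gaussianDensity t : EuclideanSpace ℝ ι → ℝ) := by
  have h := GaussianFourier.integrable_cexp_neg_mul_sq_norm_add (V := EuclideanSpace ℝ ι)
    (b := (((2 * t)⁻¹ : ℝ) : ℂ)) (by rw [Complex.ofReal_re]; positivity) 0 0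
  unfold gaussianDensity
  refine Integrable.const_mul ?_ _
  convert h.re using 2 with x
  rw [zero_mul, add_zero]
  have : (-(((2 * t)⁻¹ : ℝ) : ℂ) * (‖x‖ : ℂ) ^ 2) = ((-(2 * t)⁻¹ * ‖x‖ ^ 2 : ℝ) : ℂ) := by
    push_cast; ring
  rw [this, ← Complex.ofReal_exp]
  exact (RCLike.ofReal_re (K := ℂ) _).symm

lemma multivariateGaussian_smul_one_eq_withDensity [DecidableEq ι] {t : ℝ} (ht : 0 < t) :
    multivariateGaussian 0 (t • (1 : Matrix ι ι ℝ))
      = volume.withDensity (fun x => ENNReal.ofReal (gaussianDensity t x)) := by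
  have : IsFiniteMeasure ((volume : Measure (EuclideanSpace ℝ ι)).withDensity
      (fun x => ENNReal.ofReal (gaussianDensity t x))) :=
    isFiniteMeasure_withDensity_ofReal (integrable_gaussianDensity ht).2
  apply Measure.ext_of_charFun
  ext x
  rw [charFun_multivariateGaussian_smul_one ht.le, charFun_apply,
    integral_withDensity_eq_integral_toReal_smul (by fun_prop) (by simp)]
  have hb : 0 < (((2 * t)⁻¹ : ℝ) : ℂ).re := by rw [Complex.ofReal_re]; positivity
  have h := GaussianFourier.integral_cexp_neg_mul_sq_norm_add (V := EuclideanSpace ℝ ι) hb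
    Complex.I x
  have h2 : ∀ y : EuclideanSpace ℝ ι, (ENNReal.ofReal (gaussianDensity t y)).toReal •
      Complex.exp (⟪y, x⟫ * Complex.I)
      = (((Real.pi / (2 * t)⁻¹) ^ ((Fintype.card ι : ℝ) / 2) : ℝ) : ℂ)⁻¹ *
        Complex.exp (-(((2 * t)⁻¹ : ℝ) : ℂ) * ‖y‖ ^ 2 + Complex.I * ⟪x, y⟫) := by
    intro y
    rw [ENNReal.toReal_ofReal (gaussianDensity_pos ht y).le, gaussianDensity, Complex.real_smul,
      Complex.exp_add, real_inner_comm, mul_comm Complex.I]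
    push_cast
    ring
  simp_rw [h2]
  rw [integral_const_mul, h, finrank_euclideanSpace, ← mul_assoc]
  have h3 : ((Real.pi : ℂ) / (((2 * t)⁻¹ : ℝ) : ℂ)) ^ ((Fintype.card ι : ℂ) / 2)
      = (((Real.pi / (2 * t)⁻¹) ^ ((Fintype.card ι : ℝ) / 2) : ℝ) : ℂ) := by
    rw [Complex.ofReal_cpow (by positivity)]
    push_cast; rfl
  rw [h3, inv_mul_cancel₀, one_mul]
  · congr 1
    have : (t : ℂ) ≠ 0 := by exact_mod_cast ht.ne'
    push_cast
    rw [Complex.I_sq]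
    field_simp
    ring
  · exact_mod_cast (by positivity : (0:ℝ) < (Real.pi / (2 * t)⁻¹) ^ ((Fintype.card ι : ℝ) / 2)).ne'

lemma multivariateGaussian_smul_one_absolutelyContinuous [DecidableEq ι] {t : ℝ} (ht : 0 < t) :
    multivariateGaussian 0 (t • (1 : Matrix ι ι ℝ)) ≪ volume := by
  rw [multivariateGaussian_smul_one_eq_withDensity ht]
  exact withDensity_absolutelyContinuous _ _

/-- Positivity of the density turns statements almost sure for the law of `W t` into
Lebesgue-almost-everywhere ones. -/
lemma absolutelyContinuous_multivariateGaussian_smul_one [DecidableEq ι] {t : ℝ} (ht : 0 < t) :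
    volume ≪ multivariateGaussian 0 (t • (1 : Matrix ι ι ℝ)) := by
  rw [multivariateGaussian_smul_one_eq_withDensity ht]
  refine withDensity_absolutelyContinuous' (by fun_prop) (ae_of_all _ fun x => ?_)
  simpa using gaussianDensity_pos ht x

lemma integrable_exp_neg_smul_of_multivariateGaussian [DecidableEq ι] {F : Type*}
    [NormedAddCommGroup F] [NormedSpace ℝ F] {t : ℝ} (ht : 0 < t) {g : EuclideanSpace ℝ ι → F}
    (hg : Integrable g (multivariateGaussian 0 (t • (1 : Matrix ι ι ℝ)))) :
    Integrable (fun x => Real.exp (-(2 * t)⁻¹ * ‖x‖ ^ 2) • g x) := by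
  rw [multivariateGaussian_smul_one_eq_withDensity ht,
    integrable_withDensity_iff_integrable_smul' (by fun_prop) (by simp)] at hg
  have hc : ((Real.pi / (2 * t)⁻¹) ^ ((Fintype.card ι : ℝ) / 2)) ≠ 0 := by positivity
  refine (hg.smul ((Real.pi / (2 * t)⁻¹) ^ ((Fintype.card ι : ℝ) / 2))).congr
    (ae_of_all _ fun x => ?_)
  simp only [Pi.smul_apply]
  rw [ENNReal.toReal_ofReal (gaussianDensity_pos ht x).le, gaussianDensity, smul_smul,
    mul_inv_cancel_left₀ hc]

end GaussianDensity

/-! ### From the martingale property to Gaussian invariance. -/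

section BrownianMartingale

variable {Ω : Type*} [mΩ : MeasurableSpace Ω] {P : Measure Ω} {n : ℕ}
  {W : ℝ≥0 → Ω → EuclideanSpace ℝ (Fin n)}

lemma IsStandardBrownianMotion.hasLaw_eval (hW : IsStandardBrownianMotion W P) (t : ℝ≥0) :
    HasLaw (W t) (multivariateGaussian 0 ((t : ℝ) • (1 : Matrix (Fin n) (Fin n) ℝ))) P := by
  have h := hW.law_increments 0 t zero_le
  simp only [NNReal.coe_zero, sub_zero] at h
  refine h.congr ?_
  filter_upwards [hW.start] with ω hω
  simp [hω]

lemma IsStandardBrownianMotion.hasLaw_eval_increment [IsProbabilityMeasure P]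
    (hW : IsStandardBrownianMotion W P) (s h : ℝ≥0) :
    HasLaw (fun ω => (W s ω, W (s + h) ω - W s ω))
      ((multivariateGaussian 0 ((s : ℝ) • (1 : Matrix (Fin n) (Fin n) ℝ))).prod
        (multivariateGaussian 0 ((h : ℝ) • (1 : Matrix (Fin n) (Fin n) ℝ)))) P := by
  have hs := hW.hasLaw_eval s
  have hi := hW.law_increments s (s + h) le_self_add
  rw [NNReal.coe_add, add_sub_cancel_left] at hi
  have hind := hW.indep_increments.indepFun_eval_sub zero_le (le_self_add (a := s) (b := h)) hW.start
  refine ⟨hs.aemeasurable.prodMk hi.aemeasurable, ?_⟩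
  have := (indepFun_iff_map_prod_eq_prod_map_map hs.aemeasurable hi.aemeasurable).1 hind
  rw [hs.map_eq, hi.map_eq] at this
  exact this

lemma ContinuousLinearEquiv.quasiMeasurePreserving_volume
    (A : EuclideanSpace ℝ (Fin n) ≃L[ℝ] EuclideanSpace ℝ (Fin n)) :
    Measure.QuasiMeasurePreserving A volume volume := by
  have := MeasureTheory.Measure.LinearMap.quasiMeasurePreserving
    (volume : Measure (EuclideanSpace ℝ (Fin n)))
    (A.toLinearEquiv : EuclideanSpace ℝ (Fin n) →ₗ[ℝ] EuclideanSpace ℝ (Fin n))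
    (LinearEquiv.isUnit_det' _).ne_zero
  exact this

/-- Allows `f` to be replaced by a measurable representative. Positive time is essential: the law at
time `0` is a point mass. -/
lemma IsStandardBrownianMotion.ae_comp_eq {F : Type*} (hW : IsStandardBrownianMotion W P)
    (A : EuclideanSpace ℝ (Fin n) ≃L[ℝ] EuclideanSpace ℝ (Fin n))
    {f g : EuclideanSpace ℝ (Fin n) → F} (hfg : f =ᵐ[volume] g) {t : ℝ≥0} (ht : 0 < t) :
    (fun ω => f (A (W t ω))) =ᵐ[P] fun ω => g (A (W t ω)) := by
  have h1 : ∀ᵐ x ∂(P.map (W t)), f (A x) = g (A x) := by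
    rw [(hW.hasLaw_eval t).map_eq]
    exact (multivariateGaussian_smul_one_absolutelyContinuous (NNReal.coe_pos.2 ht)).ae_le
      (A.quasiMeasurePreserving_volume.ae hfg)
  exact ae_of_ae_map (hW.hasLaw_eval t).aemeasurable h1

variable {F : Type*} [NormedAddCommGroup F] [NormedSpace ℝ F] [CompleteSpace F]

lemma IsStandardBrownianMotion.integrable_comp_multivariateGaussian
    [IsProbabilityMeasure P] {ℱ : Filtration ℝ≥0 mΩ}
    (hW : IsStandardBrownianMotion W P)
    (A : EuclideanSpace ℝ (Fin n) ≃L[ℝ] EuclideanSpace ℝ (Fin n))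
    {f g : EuclideanSpace ℝ (Fin n) → F} (hfg : f =ᵐ[volume] g) (hg : StronglyMeasurable g)
    (hmart : Martingale (fun t ω => f (A (W t ω))) ℱ P) {t : ℝ≥0} (ht : 0 < t) :
    Integrable (fun x => g (A x))
      (multivariateGaussian 0 ((t : ℝ) • (1 : Matrix (Fin n) (Fin n) ℝ))) := by
  have hl := hW.hasLaw_eval t
  have hgA : StronglyMeasurable fun x => g (A x) := hg.comp_measurable A.continuous.measurable
  rw [← hl.map_eq, integrable_map_measure hgA.aestronglyMeasurable hl.aemeasurable]
  exact (hmart.integrable t).congr (hW.ae_comp_eq A hfg ht)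

lemma IsStandardBrownianMotion.ae_eq_integral_of_martingale
    [IsProbabilityMeasure P] {ℱ : Filtration ℝ≥0 mΩ}
    (hW : IsStandardBrownianMotion W P) (hWℱ : StronglyAdapted ℱ W)
    (A : EuclideanSpace ℝ (Fin n) ≃L[ℝ] EuclideanSpace ℝ (Fin n))
    {f g : EuclideanSpace ℝ (Fin n) → F} (hfg : f =ᵐ[volume] g) (hg : StronglyMeasurable g)
    (hmart : Martingale (fun t ω => f (A (W t ω))) ℱ P) {h : ℝ} (hh : 0 < h) :
    ∀ᵐ x, ∫ y, g (x + √h • A y) ∂(stdGaussian (EuclideanSpace ℝ (Fin n))) = g x := by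
  lift h to ℝ≥0 using hh.le
  have hh' : 0 < h := NNReal.coe_pos.1 hh
  -- Time `1` is an arbitrary positive starting time; only equivalence of its law with Lebesgue
  -- measure matters.
  set N1 := multivariateGaussian 0 (((1 : ℝ≥0) : ℝ) • (1 : Matrix (Fin n) (Fin n) ℝ)) with hN1
  set Nh := multivariateGaussian 0 ((h : ℝ) • (1 : Matrix (Fin n) (Fin n) ℝ)) with hNh
  have hl := hW.hasLaw_eval 1
  have hp := hW.hasLaw_eval_increment 1 h
  rw [← hN1] at hl
  rw [← hN1, ← hNh] at hp
  have hgA : StronglyMeasurable fun x => g (A x) := hg.comp_measurable A.continuous.measurable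
  have hgA2 : StronglyMeasurable fun z : EuclideanSpace ℝ (Fin n) × EuclideanSpace ℝ (Fin n) =>
      g (A (z.1 + z.2)) :=
    hgA.comp_measurable (measurable_fst.add measurable_snd)
  have hint1 : Integrable (fun x => g (A x)) N1 :=
    hW.integrable_comp_multivariateGaussian A hfg hg hmart one_pos
  have hcongr : (fun ω => f (A (W (1 + h) ω)))
      =ᵐ[P] fun ω => g (A (W 1 ω + (W (1 + h) ω - W 1 ω))) := by
    filter_upwards [hW.ae_comp_eq A hfg (t := 1 + h) (by positivity)] with ω hω
    rw [hω, add_sub_cancel]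
  have hint2 : Integrable (fun z : EuclideanSpace ℝ (Fin n) × EuclideanSpace ℝ (Fin n) =>
      g (A (z.1 + z.2))) (N1.prod Nh) := by
    rw [← hp.map_eq, integrable_map_measure hgA2.aestronglyMeasurable hp.aemeasurable]
    exact (hmart.integrable (1 + h)).congr hcongr
  have key : (fun x => g (A x)) =ᵐ[N1] fun x => ∫ y, g (A (x + y)) ∂Nh := by
    refine Integrable.ae_eq_of_forall_setIntegral_eq _ _ hint1 hint2.integral_prod_left ?_
    intro B hB _
    have hS : MeasurableSet[ℱ 1] (W 1 ⁻¹' B) := (hWℱ 1).measurable hB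
    have h1 := hmart.setIntegral_eq (le_self_add : (1 : ℝ≥0) ≤ 1 + h) hS
    have h2 : ∫ ω in W 1 ⁻¹' B, f (A (W 1 ω)) ∂P = ∫ x in B, g (A x) ∂N1 := by
      rw [← hl.map_eq, setIntegral_map hB hgA.aestronglyMeasurable hl.aemeasurable]
      exact integral_congr_ae (ae_restrict_of_ae (hW.ae_comp_eq A hfg one_pos))
    have h3 : ∫ ω in W 1 ⁻¹' B, f (A (W (1 + h) ω)) ∂P
        = ∫ x in B, ∫ y, g (A (x + y)) ∂Nh ∂N1 := by
      rw [integral_congr_ae (ae_restrict_of_ae hcongr)]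
      have h4 := setIntegral_prod (μ := N1) (ν := Nh) (fun z : EuclideanSpace ℝ (Fin n) ×
        EuclideanSpace ℝ (Fin n) => g (A (z.1 + z.2))) (s := B) (t := Set.univ)
        hint2.integrableOn
      simp only [Measure.restrict_univ] at h4
      rw [← h4, ← hp.map_eq, setIntegral_map (hB.prod MeasurableSet.univ)
        hgA2.aestronglyMeasurable hp.aemeasurable]
      congr 2
      ext ω
      simp
    rw [← h2, ← h3, h1]
  have key2 : ∀ᵐ x, g (A x) = ∫ y, g (A (x + y)) ∂Nh :=
    (absolutelyContinuous_multivariateGaussian_smul_one one_pos).ae_le key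
  filter_upwards [A.symm.quasiMeasurePreserving_volume.ae key2] with x hx
  rw [A.apply_symm_apply] at hx
  rw [hx, hNh, multivariateGaussian_smul_one_eq_map hh.le, integral_map (by fun_prop)]
  · simp
  · exact (hgA.comp_measurable (measurable_const_add _)).aestronglyMeasurable

lemma IsStandardBrownianMotion.integrable_exp_neg_smul_of_martingale
    [IsProbabilityMeasure P] {ℱ : Filtration ℝ≥0 mΩ}
    (hW : IsStandardBrownianMotion W P)
    (A : EuclideanSpace ℝ (Fin n) ≃L[ℝ] EuclideanSpace ℝ (Fin n))
    {f g : EuclideanSpace ℝ (Fin n) → F} (hfg : f =ᵐ[volume] g) (hg : StronglyMeasurable g)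
    (hmart : Martingale (fun t ω => f (A (W t ω))) ℱ P) {c : ℝ} (hc : 0 < c) :
    Integrable (fun x => Real.exp (-c * ‖x‖ ^ 2) • g x) := by
  -- `K` dominates `‖A⁻¹‖²`, so `exp (-c‖x‖²) ≤ exp (-(c/K)‖A⁻¹x‖²)`; the `+ 1` keeps it positive.
  -- The time used next is the one with `(2t)⁻¹ = c/K`.
  set K := ‖(A.symm : EuclideanSpace ℝ (Fin n) →L[ℝ] EuclideanSpace ℝ (Fin n))‖ ^ 2 + 1 with hK
  have hK0 : 0 < K := by positivity
  have ht : 0 < (2 * (c / K))⁻¹ := by positivity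
  have h1 := integrable_exp_neg_smul_of_multivariateGaussian ht
    (hW.integrable_comp_multivariateGaussian A hfg hg hmart (t := ⟨_, ht.le⟩) ht)
  have h0 : (2 * (2 * (c / K))⁻¹)⁻¹ = c / K := by field_simp
  rw [h0] at h1
  set G : EuclideanSpace ℝ (Fin n) → F :=
    fun x => Real.exp (-(c / K) * ‖A.symm x‖ ^ 2) • g x with hG
  have hGm : StronglyMeasurable G :=
    (by fun_prop : Measurable fun x => Real.exp (-(c / K) * ‖A.symm x‖ ^ 2)).stronglyMeasurable.smul
      hg
  have h2 : Integrable G (volume.map A) := by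
    rw [integrable_map_measure hGm.aestronglyMeasurable (by fun_prop)]
    refine h1.congr (ae_of_all _ fun x => ?_)
    simp [hG]
  have h3 : Integrable G := by
    have hmap := Measure.map_linearMap_addHaar_eq_smul_addHaar
      (volume : Measure (EuclideanSpace ℝ (Fin n)))
      (f := (A.toLinearEquiv : EuclideanSpace ℝ (Fin n) →ₗ[ℝ] EuclideanSpace ℝ (Fin n)))
      (LinearEquiv.isUnit_det' _).ne_zero
    have hmap' : volume.map A = _ := hmap
    have hdet := (LinearEquiv.isUnit_det' A.toLinearEquiv).ne_zero
    rw [hmap', integrable_smul_measure (by simpa using hdet) (by simp)] at h2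
    exact h2
  have hm : Measurable fun x : EuclideanSpace ℝ (Fin n) => Real.exp (-c * ‖x‖ ^ 2) := by fun_prop
  refine h3.mono (hm.stronglyMeasurable.smul hg).aestronglyMeasurable (ae_of_all _ fun x => ?_)
  rw [norm_smul, hG, norm_smul, Real.norm_of_nonneg (Real.exp_pos _).le,
    Real.norm_of_nonneg (Real.exp_pos _).le]
  refine mul_le_mul_of_nonneg_right (Real.exp_le_exp.2 ?_) (norm_nonneg _)
  have h4 : ‖A.symm x‖ ^ 2 ≤ K * ‖x‖ ^ 2 := by
    have := (A.symm : EuclideanSpace ℝ (Fin n) →L[ℝ] EuclideanSpace ℝ (Fin n)).le_opNorm x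
    calc ‖A.symm x‖ ^ 2 ≤ (‖(A.symm : EuclideanSpace ℝ (Fin n) →L[ℝ] EuclideanSpace ℝ (Fin n))‖
          * ‖x‖) ^ 2 := by gcongr; exact this
      _ ≤ K * ‖x‖ ^ 2 := by rw [mul_pow, hK]; nlinarith [sq_nonneg ‖x‖]
  have h5 : c / K * ‖A.symm x‖ ^ 2 ≤ c / K * (K * ‖x‖ ^ 2) := by gcongr
  have h6 : c / K * (K * ‖x‖ ^ 2) = c * ‖x‖ ^ 2 := by field_simp
  linarith

end BrownianMartingale

/-! ### Symmetric second differences. -/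

section SecondDifference

open Filter Topology

variable {E F : Type*} [NormedAddCommGroup E] [NormedSpace ℝ E] [NormedAddCommGroup F]
  [NormedSpace ℝ F]

/-- Mean value inequality for `s ↦ u (s + w) - u s - T s` between `x - w` and `x`. -/
lemma norm_second_difference_sub_le {u : E → F} (hu : Differentiable ℝ u) {T : E →L[ℝ] F}
    {x w : E} {C : ℝ}
    (hC : ∀ s ∈ segment ℝ (x - w) x, ‖fderiv ℝ u (s + w) - fderiv ℝ u s - T‖ ≤ C) :
    ‖u (x + w) + u (x - w) - (2 : ℝ) • u x - T w‖ ≤ C * ‖w‖ := by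
  have hg : ∀ s ∈ segment ℝ (x - w) x, HasFDerivWithinAt (fun s => u (s + w) - u s - T s)
      (fderiv ℝ u (s + w) - fderiv ℝ u s - T) (segment ℝ (x - w) x) s := by
    intro s _
    refine HasFDerivAt.hasFDerivWithinAt ?_
    refine HasFDerivAt.sub (HasFDerivAt.sub ?_ (hu s).hasFDerivAt) T.hasFDerivAt
    exact (hasFDerivAt_comp_add_right w).2 (hu (s + w)).hasFDerivAt
  have := (convex_segment (x - w) x).norm_image_sub_le_of_norm_hasFDerivWithin_le hg hC
    (left_mem_segment ℝ _ _) (right_mem_segment ℝ _ _)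
  simp only [sub_add_cancel, sub_sub_cancel] at this
  convert this using 2
  rw [map_sub, two_smul]
  abel

lemma HasCompactSupport.exists_second_difference_le {φ : E → F} (hφ : HasCompactSupport φ)
    (hd : ContDiff ℝ 2 φ) :
    ∃ M : ℝ, 0 ≤ M ∧ ∀ x w, ‖φ (x + w) + φ (x - w) - (2 : ℝ) • φ x‖ ≤ M * ‖w‖ ^ 2 := by
  obtain ⟨C, hC⟩ := (hd.fderiv_right (m := 1) (by norm_num)).lipschitzWith_of_hasCompactSupport
    (hφ.fderiv ℝ) one_ne_zero
  refine ⟨C, C.2, fun x w => ?_⟩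
  have := norm_second_difference_sub_le (u := φ) (T := 0) (x := x) (w := w) (C := C * ‖w‖)
    (hd.differentiable two_ne_zero) (fun s _ => by
      have := hC.dist_le_mul (s + w) s
      simpa [dist_eq_norm] using this)
  simpa [sq, mul_assoc] using this

/-- Strict differentiability of `fderiv ℝ u` is what is needed: the derivatives compared, at `s + ε
• v` and `s`, are both taken near `x` but in general not at `x`. -/
lemma ContDiff.tendsto_second_difference {u : E → F} (hu : ContDiff ℝ 2 u) (x v : E) :
    Tendsto (fun ε : ℝ => (ε ^ 2)⁻¹ • (u (x + ε • v) + u (x - ε • v) - (2 : ℝ) • u x)) (𝓝[>] 0)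
      (𝓝 (fderiv ℝ (fderiv ℝ u) x v v)) := by
  have hd : HasStrictFDerivAt (fderiv ℝ u) (fderiv ℝ (fderiv ℝ u) x) x :=
    (hu.fderiv_right (m := 1) (by norm_num)).contDiffAt.hasStrictFDerivAt one_ne_zero
  set D := fderiv ℝ (fderiv ℝ u) x
  rw [Metric.tendsto_nhds]
  intro η hη
  have hη' : 0 < η / (2 * (‖v‖ ^ 2 + 1)) := by positivity
  obtain ⟨δ, hδ, hball⟩ := Metric.eventually_nhds_iff_ball.1 (hd.isLittleO.def hη')
  have hsmall : ∀ᶠ ε : ℝ in 𝓝[>] 0, ε * ‖v‖ < δ := by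
    have : Tendsto (fun ε : ℝ => ε * ‖v‖) (𝓝 0) (𝓝 (0 * ‖v‖)) :=
      (continuous_id.mul continuous_const).tendsto 0
    rw [zero_mul] at this
    exact (this.mono_left nhdsWithin_le_nhds).eventually (gt_mem_nhds hδ)
  filter_upwards [hsmall, self_mem_nhdsWithin] with ε hε hε0
  have hε0 : 0 < ε := hε0
  have hn : ‖ε • v‖ = ε * ‖v‖ := by rw [norm_smul, Real.norm_of_nonneg hε0.le]
  have key := norm_second_difference_sub_le (u := u) (T := D (ε • v)) (x := x) (w := ε • v)
    (C := η / (2 * (‖v‖ ^ 2 + 1)) * ‖ε • v‖) (hu.differentiable two_ne_zero) (by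
      intro s hs
      have h1 : s ∈ Metric.ball x δ := by
        refine (convex_ball x δ).segment_subset ?_ (Metric.mem_ball_self hδ) hs
        simpa [hn] using hε
      have h2 : s + ε • v ∈ Metric.ball x δ := by
        obtain ⟨a, b, ha, hb, hab, rfl⟩ := hs
        have h3 : a • (x - ε • v) + b • x + ε • v - x = b • (ε • v) := by
          obtain rfl : b = 1 - a := by linarith
          module
        rw [mem_ball_iff_norm, h3, norm_smul, Real.norm_of_nonneg hb, hn]
        have : b * (ε * ‖v‖) ≤ 1 * (ε * ‖v‖) := by gcongr; linarith
        linarith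
      have h4 := hball (s + ε • v, s) (by
        rw [← ball_prod_same]
        exact ⟨h2, h1⟩)
      simpa using h4)
  rw [dist_eq_norm]
  have h5 : (ε ^ 2)⁻¹ • (u (x + ε • v) + u (x - ε • v) - (2 : ℝ) • u x) - D v v
      = (ε ^ 2)⁻¹ • (u (x + ε • v) + u (x - ε • v) - (2 : ℝ) • u x - D (ε • v) (ε • v)) := by
    rw [smul_sub _ _ (D (ε • v) (ε • v))]
    congr 1
    simp only [map_smul, _root_.smul_apply, smul_smul]
    rw [← sq, inv_mul_cancel₀ (by positivity), one_smul]
  rw [h5, norm_smul, Real.norm_of_nonneg (by positivity)]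
  calc (ε ^ 2)⁻¹ * _ ≤ (ε ^ 2)⁻¹ * (η / (2 * (‖v‖ ^ 2 + 1)) * ‖ε • v‖ * ‖ε • v‖) := by gcongr
    _ = η / 2 * (‖v‖ ^ 2 / (‖v‖ ^ 2 + 1)) := by rw [hn]; field_simp
    _ ≤ η / 2 * 1 := by
      gcongr
      rw [div_le_one (by positivity)]
      linarith
    _ < η := by linarith

end SecondDifference

/-! ### Mollification and the averaged Hessian. -/

section Mollification

open Filter Topology Metric
open scoped Convolution

lemma norm_le_exp_mul_norm_exp_neg_smul {E F : Type*} [NormedAddCommGroup E]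
    [NormedAddCommGroup F] [NormedSpace ℝ F] {f : E → F} {c : ℝ} (hc : 0 < c) {x z : E} {r : ℝ}
    (hz : z ∈ closedBall x r) :
    ‖f z‖ ≤ Real.exp (c * (‖x‖ + r) ^ 2) * ‖Real.exp (-c * ‖z‖ ^ 2) • f z‖ := by
  rw [norm_smul, Real.norm_of_nonneg (Real.exp_pos _).le, ← mul_assoc, ← Real.exp_add]
  refine le_mul_of_one_le_left (norm_nonneg _) (Real.one_le_exp ?_)
  have h1 : ‖z‖ ≤ ‖x‖ + r := by
    have := norm_le_norm_add_norm_sub' z x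
    rw [mem_closedBall_iff_norm] at hz
    linarith
  have : ‖z‖ ^ 2 ≤ (‖x‖ + r) ^ 2 := by gcongr
  nlinarith

lemma HasCompactSupport.exists_bound_radius {E : Type*} [NormedAddCommGroup E] {ψ : E → ℝ} (hψ : HasCompactSupport ψ)
    (hc : Continuous ψ) : ∃ M R : ℝ, 0 ≤ M ∧ 0 ≤ R ∧ (∀ t, |ψ t| ≤ M) ∧ ∀ t, R < ‖t‖ → ψ t = 0 := by
  obtain ⟨M, hM⟩ := hc.bounded_above_of_compact_support hψ
  obtain ⟨R, hR⟩ := hψ.isBounded.subset_closedBall 0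
  refine ⟨M, max R 0, (norm_nonneg _).trans (hM 0), le_max_right _ _, hM, fun t ht => ?_⟩
  by_contra h
  have := hR (subset_tsupport ψ h)
  rw [mem_closedBall_zero_iff] at this
  exact (this.trans (le_max_left R 0)).not_gt ht

lemma integrable_comp_neg_stdGaussian {E F : Type*} [NormedAddCommGroup E]
    [InnerProductSpace ℝ E] [FiniteDimensional ℝ E] [MeasurableSpace E] [BorelSpace E]
    [NormedAddCommGroup F] {g : E → F} (hg : Integrable g (stdGaussian E)) :
    Integrable (fun y => g (-y)) (stdGaussian E) := by
  rw [← stdGaussian_map (LinearIsometryEquiv.neg ℝ : E ≃ₗᵢ[ℝ] E)] at hg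
  exact hg.comp_measurable (LinearIsometryEquiv.neg ℝ : E ≃ₗᵢ[ℝ] E).continuous.measurable

variable {E F : Type*} [NormedAddCommGroup E] [InnerProductSpace ℝ E] [FiniteDimensional ℝ E]
  [MeasurableSpace E] [BorelSpace E] [NormedAddCommGroup F] [NormedSpace ℝ F] {f : E → F}

lemma integrableOn_closedBall_of_exp_neg_smul (hfm : StronglyMeasurable f) {c : ℝ} (hc : 0 < c)
    (hf : Integrable fun x => Real.exp (-c * ‖x‖ ^ 2) • f x) (x : E) (r : ℝ) :
    IntegrableOn f (closedBall x r) :=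
  Integrable.mono' (hf.norm.const_mul (Real.exp (c * (‖x‖ + r) ^ 2))).integrableOn
    hfm.aestronglyMeasurable
    ((ae_restrict_iff' measurableSet_closedBall).2
      (ae_of_all _ fun _ hz => norm_le_exp_mul_norm_exp_neg_smul hc hz))

lemma setIntegral_closedBall_norm_le (hfm : StronglyMeasurable f) {c : ℝ} (hc : 0 < c)
    (hf : Integrable fun x => Real.exp (-c * ‖x‖ ^ 2) • f x) (x : E) (r : ℝ) :
    ∫ z in closedBall x r, ‖f z‖
      ≤ Real.exp (c * (‖x‖ + r) ^ 2) * ∫ z, ‖Real.exp (-c * ‖z‖ ^ 2) • f z‖ := by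
  rw [← integral_const_mul]
  have hi := hf.norm.const_mul (Real.exp (c * (‖x‖ + r) ^ 2))
  calc _ ≤ ∫ z in closedBall x r,
        Real.exp (c * (‖x‖ + r) ^ 2) * ‖Real.exp (-c * ‖z‖ ^ 2) • f z‖ :=
        setIntegral_mono_on (integrableOn_closedBall_of_exp_neg_smul hfm hc hf x r).norm
          hi.integrableOn measurableSet_closedBall
          fun z hz => norm_le_exp_mul_norm_exp_neg_smul hc hz
    _ ≤ _ := setIntegral_le_integral hi (ae_of_all _ fun _ => by positivity)

lemma locallyIntegrable_of_exp_neg_smul (hfm : StronglyMeasurable f) {c : ℝ} (hc : 0 < c)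
    (hf : Integrable fun x => Real.exp (-c * ‖x‖ ^ 2) • f x) : LocallyIntegrable f := by
  intro x
  exact ⟨closedBall x 1, closedBall_mem_nhds x one_pos,
    integrableOn_closedBall_of_exp_neg_smul hfm hc hf x 1⟩

/-- Averages of `‖f‖` over balls of radius growing linearly in a Gaussian variable are dominated by
an integrable function. -/
lemma exists_integrable_stdGaussian_bound (hfm : StronglyMeasurable f)
    (hf : ∀ c : ℝ, 0 < c → Integrable fun x => Real.exp (-c * ‖x‖ ^ 2) • f x)
    (B : E →L[ℝ] E) (x : E) {R : ℝ} :
    ∃ g : E → ℝ, Integrable g (stdGaussian E) ∧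
      ∀ y, (1 + ‖B y‖ ^ 2) * ∫ z in closedBall x (R + ‖B y‖), ‖f z‖ ≤ g y := by
  obtain ⟨C, hC, hint⟩ := IsGaussian.exists_integrable_exp_sq (stdGaussian E)
  -- `C` is a Fernique exponent. The choice gives `4c‖B‖² ≤ C`: one factor `exp (2c‖B y‖²)` absorbs
  -- `1 + ‖B y‖²`, another comes from expanding the square of `‖x‖ + R + ‖B y‖`.
  set c := C / (4 * (‖B‖ ^ 2 + 1)) with hcdef
  have hc : 0 < c := by positivity
  have hcC : 4 * c * ‖B‖ ^ 2 ≤ C := by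
    have : 4 * c * (‖B‖ ^ 2 + 1) = C := by rw [hcdef]; field_simp
    nlinarith
  set I := ∫ z, ‖Real.exp (-c * ‖z‖ ^ 2) • f z‖
  have hI : 0 ≤ I := integral_nonneg fun _ => norm_nonneg _
  refine ⟨fun y => (1 + 1 / (2 * c)) * Real.exp (2 * c * (‖x‖ + R) ^ 2) * I *
    Real.exp (C * ‖y‖ ^ 2), hint.const_mul _, fun y => ?_⟩
  set b := ‖B y‖
  have h1 : 1 + b ^ 2 ≤ (1 + 1 / (2 * c)) * Real.exp (2 * c * b ^ 2) := by
    have h2 : 1 ≤ Real.exp (2 * c * b ^ 2) := Real.one_le_exp (by positivity)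
    have h3 : 2 * c * b ^ 2 ≤ Real.exp (2 * c * b ^ 2) := by
      linarith [Real.add_one_le_exp (2 * c * b ^ 2)]
    have h4 : b ^ 2 ≤ 1 / (2 * c) * Real.exp (2 * c * b ^ 2) := by
      rw [one_div, ← div_eq_inv_mul, le_div_iff₀ (by positivity)]
      linarith
    linarith
  have h5 : Real.exp (c * (‖x‖ + (R + b)) ^ 2)
      ≤ Real.exp (2 * c * (‖x‖ + R) ^ 2) * Real.exp (2 * c * b ^ 2) := by
    rw [← Real.exp_add, Real.exp_le_exp]
    nlinarith [mul_nonneg hc.le (sq_nonneg (‖x‖ + R - b))]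
  have h6 : Real.exp (2 * c * b ^ 2) * Real.exp (2 * c * b ^ 2) ≤ Real.exp (C * ‖y‖ ^ 2) := by
    rw [← Real.exp_add, Real.exp_le_exp]
    have : b ^ 2 ≤ ‖B‖ ^ 2 * ‖y‖ ^ 2 := by
      rw [← mul_pow]
      have := B.le_opNorm y
      gcongr
    calc 2 * c * b ^ 2 + 2 * c * b ^ 2 = 4 * c * b ^ 2 := by ring
      _ ≤ 4 * c * (‖B‖ ^ 2 * ‖y‖ ^ 2) := by gcongr
      _ = 4 * c * ‖B‖ ^ 2 * ‖y‖ ^ 2 := by ring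
      _ ≤ C * ‖y‖ ^ 2 := by gcongr
  calc (1 + b ^ 2) * ∫ z in closedBall x (R + b), ‖f z‖
      ≤ ((1 + 1 / (2 * c)) * Real.exp (2 * c * b ^ 2)) *
        (Real.exp (2 * c * (‖x‖ + R) ^ 2) * Real.exp (2 * c * b ^ 2) * I) := by
        gcongr
        exact (setIntegral_closedBall_norm_le hfm hc (hf c hc) x _).trans
          (mul_le_mul_of_nonneg_right h5 hI)
    _ = (1 + 1 / (2 * c)) * Real.exp (2 * c * (‖x‖ + R) ^ 2) * I *
        (Real.exp (2 * c * b ^ 2) * Real.exp (2 * c * b ^ 2)) := by ring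
    _ ≤ _ := mul_le_mul_of_nonneg_left h6 (by positivity)

lemma integral_norm_smul_comp_sub_le (hloc : ∀ x r, IntegrableOn f (closedBall x r))
    {ψ : E → ℝ} {M R : ℝ} (hM : ∀ t, |ψ t| ≤ M) (hR : ∀ t, R < ‖t‖ → ψ t = 0) (z : E) :
    ∫ t, ‖ψ t • f (z - t)‖ ≤ M * ∫ s in closedBall z R, ‖f s‖ := by
  have h := integral_sub_left_eq_self (fun t => ‖ψ t • f (z - t)‖) volume z
  simp only [sub_sub_cancel] at h
  rw [← h, ← integral_const_mul, ← integral_indicator measurableSet_closedBall]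
  refine integral_mono_of_nonneg (ae_of_all _ fun _ => norm_nonneg _)
    ((integrable_indicator_iff measurableSet_closedBall).2 ((hloc z R).norm.const_mul M))
    (ae_of_all _ fun s => ?_)
  simp only
  by_cases hs : s ∈ closedBall z R
  · rw [Set.indicator_of_mem hs, norm_smul, Real.norm_eq_abs]
    gcongr
    exact hM _
  · rw [Set.indicator_of_notMem hs, hR, zero_smul, norm_zero]
    rw [mem_closedBall_iff_norm', not_le] at hs
    exact hs

lemma integrable_smul_comp_sub (hloc : LocallyIntegrable f) {ψ : E → ℝ}
    (hψ : HasCompactSupport ψ) (hc : Continuous ψ) (z : E) :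
    Integrable fun t => ψ t • f (z - t) :=
  hψ.convolutionExists_left (ContinuousLinearMap.lsmul ℝ ℝ) hc hloc z

/-- Fubini: translation-invariant averaging commutes with convolution, and integrating against `φ`
upgrades the almost everywhere identity to every `x`. -/
lemma integral_convolution_add_stdGaussian [CompleteSpace F] (hfm : StronglyMeasurable f)
    (hf : ∀ c : ℝ, 0 < c → Integrable fun x => Real.exp (-c * ‖x‖ ^ 2) • f x)
    (B : E →L[ℝ] E) (hB : ∀ᵐ x, ∫ y, f (x + B y) ∂(stdGaussian E) = f x)
    {φ : E → ℝ} (hφ : HasCompactSupport φ) (hφc : Continuous φ) (x : E) :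
    Integrable (fun y => (φ ⋆[ContinuousLinearMap.lsmul ℝ ℝ, volume] f) (x + B y)) (stdGaussian E) ∧
    ∫ y, (φ ⋆[ContinuousLinearMap.lsmul ℝ ℝ, volume] f) (x + B y) ∂(stdGaussian E)
      = (φ ⋆[ContinuousLinearMap.lsmul ℝ ℝ, volume] f) x := by
  obtain ⟨M, R, hM0, hR0, hM, hR⟩ := hφ.exists_bound_radius hφc
  have hloc := locallyIntegrable_of_exp_neg_smul hfm one_pos (hf 1 one_pos)
  have hball := integrableOn_closedBall_of_exp_neg_smul hfm one_pos (hf 1 one_pos)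
  obtain ⟨g, hg, hgb⟩ := exists_integrable_stdGaussian_bound hfm hf B x (R := R)
  have hGm : StronglyMeasurable fun p : E × E => φ p.1 • f (x + B p.2 - p.1) :=
    (hφc.measurable.comp measurable_fst).stronglyMeasurable.smul
      (hfm.comp_measurable (by fun_prop))
  have hG : Integrable (fun p : E × E => φ p.1 • f (x + B p.2 - p.1))
      (volume.prod (stdGaussian E)) := by
    rw [integrable_prod_iff' hGm.aestronglyMeasurable]
    refine ⟨ae_of_all _ fun y => integrable_smul_comp_sub hloc hφ hφc (x + B y), ?_⟩
    refine (hg.const_mul M).mono' ?_ (ae_of_all _ fun y => ?_)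
    · exact (hGm.norm.comp_measurable measurable_swap).integral_prod_right'.aestronglyMeasurable
    · rw [Real.norm_of_nonneg (integral_nonneg fun _ => norm_nonneg _)]
      refine (integral_norm_smul_comp_sub_le hball hM hR (x + B y)).trans ?_
      gcongr
      refine le_trans ?_ (hgb y)
      have h1 : ∫ s in closedBall (x + B y) R, ‖f s‖
          ≤ ∫ s in closedBall x (R + ‖B y‖), ‖f s‖ := by
        refine setIntegral_mono_set (hball _ _).norm (ae_of_all _ fun _ => norm_nonneg _)
          (LE.le.eventuallyLE (closedBall_subset_closedBall' ?_))
        simp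
      have h2 : 0 ≤ ∫ s in closedBall x (R + ‖B y‖), ‖f s‖ :=
        integral_nonneg fun _ => norm_nonneg _
      nlinarith [sq_nonneg ‖B y‖]
  refine ⟨hG.integral_prod_right, ?_⟩
  simp only [convolution_def, ContinuousLinearMap.lsmul_apply]
  rw [integral_integral_swap (f := fun y t => φ t • f (x + B y - t)) hG.swap]
  refine integral_congr_ae ?_
  have hq := (quasiMeasurePreserving_sub_left_of_right_invariant volume x).ae hB
  filter_upwards [hq] with t ht
  rw [integral_smul, ← ht]
  congr 2 with y
  rw [add_sub_right_comm]

lemma integral_comp_neg_stdGaussian (g : E → F) :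
    ∫ y, g (-y) ∂(stdGaussian E) = ∫ y, g y ∂(stdGaussian E) := by
  conv_rhs => rw [← stdGaussian_map (LinearIsometryEquiv.neg ℝ : E ≃ₗᵢ[ℝ] E)]
  exact ((LinearIsometryEquiv.neg ℝ : E ≃ₗᵢ[ℝ] E).toHomeomorph.toMeasurableEquiv.measurableEmbedding.integral_map
    _).symm

/-- Moves the difference onto the smooth `φ`, so that second differences of `φ ⋆ f` are controlled
by local integrals of `‖f‖`. -/
lemma second_difference_convolution (hloc : LocallyIntegrable f)
    {φ : E → ℝ} (hφ : HasCompactSupport φ) (hφc : Continuous φ) (x w : E) :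
    (φ ⋆[ContinuousLinearMap.lsmul ℝ ℝ, volume] f) (x + w)
      + (φ ⋆[ContinuousLinearMap.lsmul ℝ ℝ, volume] f) (x - w)
      - (2 : ℝ) • (φ ⋆[ContinuousLinearMap.lsmul ℝ ℝ, volume] f) x
    = ∫ t, (φ (t + w) + φ (t - w) - (2 : ℝ) • φ t) • f (x - t) := by
  have key : ∀ v, (φ ⋆[ContinuousLinearMap.lsmul ℝ ℝ, volume] f) (x + v)
      = ∫ t, φ (t + v) • f (x - t) := by
    intro v
    simp only [convolution_def, ContinuousLinearMap.lsmul_apply]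
    rw [← integral_add_right_eq_self _ v]
    simp
  have hint : ∀ v, Integrable fun t => φ (t + v) • f (x - t) := fun v => by
    refine integrable_smul_comp_sub hloc (ψ := fun t => φ (t + v)) ?_ (by fun_prop) x
    exact hφ.comp_homeomorph (Homeomorph.addRight v)
  have k0 := key 0
  have i0 := hint 0
  simp only [add_zero] at k0 i0
  have hi1 := hint w
  have hi2 := hint (-w)
  have k2 := key (-w)
  simp only [← sub_eq_add_neg] at hi2 k2
  simp only [sub_smul, add_smul, smul_assoc]
  rw [integral_sub (hi1.fun_add hi2) (i0.fun_smul (2 : ℝ)), integral_add hi1 hi2, integral_smul,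
    key w, k2, k0]

/-- Invariance with `h = ε²`, together with the symmetry `y ↦ -y` of the Gaussian, makes averaged
second differences vanish; dominated convergence passes to `ε → 0`. -/
lemma integral_hessian_convolution_eq_zero [CompleteSpace F] (hfm : StronglyMeasurable f)
    (hf : ∀ c : ℝ, 0 < c → Integrable fun x => Real.exp (-c * ‖x‖ ^ 2) • f x)
    (A : E →L[ℝ] E)
    (hA : ∀ h : ℝ, 0 < h → ∀ᵐ x, ∫ y, f (x + √h • A y) ∂(stdGaussian E) = f x)
    {φ : E → ℝ} (hφ : HasCompactSupport φ) (hφd : ContDiff ℝ 2 φ) (x : E) :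
    ∫ y, fderiv ℝ (fderiv ℝ (φ ⋆[ContinuousLinearMap.lsmul ℝ ℝ, volume] f)) x (A y) (A y)
      ∂(stdGaussian E) = 0 := by
  have hloc := locallyIntegrable_of_exp_neg_smul hfm one_pos (hf 1 one_pos)
  have hball := integrableOn_closedBall_of_exp_neg_smul hfm one_pos (hf 1 one_pos)
  set u := φ ⋆[ContinuousLinearMap.lsmul ℝ ℝ, volume] f with hudef
  have hu : ContDiff ℝ 2 u :=
    hφ.contDiff_convolution_left (n := 2) (ContinuousLinearMap.lsmul ℝ ℝ) hφd hloc
  have hφc := hφd.continuous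
  obtain ⟨-, R, -, hR0, -, hR⟩ := hφ.exists_bound_radius hφc
  obtain ⟨M, hM0, hM⟩ := hφ.exists_second_difference_le hφd
  obtain ⟨g, hg, hgb⟩ := exists_integrable_stdGaussian_bound hfm hf A x (R := R)
  have hzero : ∀ ε : ℝ, 0 < ε → ∫ y, (ε ^ 2)⁻¹ • (u (x + ε • A y) + u (x - ε • A y)
      - (2 : ℝ) • u x) ∂(stdGaussian E) = 0 := by
    intro ε hε
    have h1 := hA (ε ^ 2) (by positivity)
    rw [Real.sqrt_sq hε.le] at h1
    obtain ⟨hi, he⟩ := integral_convolution_add_stdGaussian hfm hf (ε • A) h1 hφ hφc x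
    rw [← hudef] at hi he
    simp only [_root_.smul_apply] at hi he
    have hi' := integrable_comp_neg_stdGaussian hi
    have he' := integral_comp_neg_stdGaussian fun y => u (x + ε • A y)
    rw [he] at he'
    simp only [map_neg, smul_neg, ← sub_eq_add_neg] at hi' he'
    rw [integral_smul, integral_sub (hi.fun_add hi') (integrable_const _), integral_add hi hi', he,
      he']
    simp [two_smul]
  have hlim : Tendsto (fun ε : ℝ => ∫ y, (ε ^ 2)⁻¹ • (u (x + ε • A y) + u (x - ε • A y)
      - (2 : ℝ) • u x) ∂(stdGaussian E)) (𝓝[>] 0)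
      (𝓝 (∫ y, fderiv ℝ (fderiv ℝ u) x (A y) (A y) ∂(stdGaussian E))) := by
    refine tendsto_integral_filter_of_dominated_convergence (fun y => M * g y)
      (Eventually.of_forall fun ε => ?_) ?_ (hg.const_mul M)
      (ae_of_all _ fun y => hu.tendsto_second_difference x (A y))
    · have := hu.continuous
      exact Continuous.aestronglyMeasurable (by fun_prop)
    · filter_upwards [Ioc_mem_nhdsGT (zero_lt_one (α := ℝ))] with ε hε
      refine ae_of_all _ fun y => ?_
      have hε0 := hε.1
      have hn : ‖ε • A y‖ = ε * ‖A y‖ := by rw [norm_smul, Real.norm_of_nonneg hε0.le]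
      have hn1 : ‖ε • A y‖ ≤ ‖A y‖ := by
        rw [hn]; exact mul_le_of_le_one_left (norm_nonneg _) hε.2
      rw [second_difference_convolution hloc hφ hφc, norm_smul,
        Real.norm_of_nonneg (by positivity)]
      -- For `ε ≤ 1` the second difference of `φ` lives in a ball of radius `R + ‖A y‖` independent
      -- of `ε`, and its size `M ε²‖A y‖²` cancels `(ε ^ 2)⁻¹`.
      have h2 := integral_norm_smul_comp_sub_le hball
        (ψ := fun t => φ (t + ε • A y) + φ (t - ε • A y) - (2 : ℝ) • φ t)
        (M := M * ‖ε • A y‖ ^ 2) (R := R + ‖A y‖) (fun t => hM t _) (fun t ht => by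
          have h3 := norm_sub_le (t + ε • A y) (ε • A y)
          have h4 := norm_add_le (t - ε • A y) (ε • A y)
          rw [add_sub_cancel_right] at h3
          rw [sub_add_cancel] at h4
          rw [hR _ (by linarith), hR _ (by linarith), hR t (by linarith [norm_nonneg (A y)])]
          simp) x
      have h5 : 0 ≤ ∫ s in closedBall x (R + ‖A y‖), ‖f s‖ :=
        integral_nonneg fun _ => norm_nonneg _
      calc (ε ^ 2)⁻¹ * _ ≤ (ε ^ 2)⁻¹ * (M * ‖ε • A y‖ ^ 2 *
            ∫ s in closedBall x (R + ‖A y‖), ‖f s‖) := by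
            gcongr
            exact (norm_integral_le_integral_norm _).trans h2
        _ = M * (‖A y‖ ^ 2 * ∫ s in closedBall x (R + ‖A y‖), ‖f s‖) := by
            rw [hn]; field_simp
        _ ≤ M * g y := by
            gcongr
            refine le_trans ?_ (hgb y)
            nlinarith
  refine tendsto_nhds_unique hlim (tendsto_const_nhds.congr' ?_)
  filter_upwards [self_mem_nhdsWithin] with ε hε using (hzero ε hε).symm

end Mollification

/-! ### Traces of bilinear forms under the coordinate mixings. -/

section BilinearForms

variable {F : Type*} [NormedAddCommGroup F] [NormedSpace ℝ F]

lemma integral_mul_stdGaussian {ι : Type*} [Fintype ι] [DecidableEq ι] (k l : ι) :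
    ∫ y, y k * y l ∂(stdGaussian (EuclideanSpace ℝ ι)) = if k = l then 1 else 0 := by
  have hmean : ∀ k : ι, ∫ y, y k ∂(stdGaussian (EuclideanSpace ℝ ι)) = 0 := fun k =>
    integral_strongDual_stdGaussian (EuclideanSpace.proj k : EuclideanSpace ℝ ι →L[ℝ] ℝ)
  have h := covariance_eval_multivariateGaussian (μ := (0 : EuclideanSpace ℝ ι))
    (Matrix.PosSemidef.one (n := ι) (R := ℝ)) k l
  rw [multivariateGaussian_zero_one, covariance, hmean, hmean] at h
  simpa [Matrix.one_apply] using h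

lemma integrable_mul_stdGaussian {ι : Type*} [Fintype ι] (k l : ι) :
    Integrable (fun y => y k * y l) (stdGaussian (EuclideanSpace ℝ ι)) := by
  have h : ∀ k : ι, MemLp (fun y => y k) 2 (stdGaussian (EuclideanSpace ℝ ι)) := fun k =>
    (EuclideanSpace.proj k : EuclideanSpace ℝ ι →L[ℝ] ℝ).comp_memLp' IsGaussian.memLp_two_id
  exact (h k).integrable_mul (h l)

lemma ContinuousLinearMap.apply_eq_sum_single {ι : Type*} [Fintype ι] [DecidableEq ι]
    (B : EuclideanSpace ℝ ι →L[ℝ] EuclideanSpace ℝ ι →L[ℝ] F) (y z : EuclideanSpace ℝ ι) :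
    B y z = ∑ k, ∑ l, (y k * z l) •
      B (EuclideanSpace.single k 1) (EuclideanSpace.single l 1) := by
  have hsum : ∀ y : EuclideanSpace ℝ ι, y = ∑ k, y k • EuclideanSpace.single k (1 : ℝ) := fun y => by
    ext i
    simp [Pi.single_apply]
  conv_lhs => rw [hsum y, hsum z]
  simp only [map_sum, map_smul, _root_.sum_apply, _root_.smul_apply, Finset.smul_sum,
    smul_smul]
  rw [Finset.sum_comm]
  simp only [mul_comm]

lemma integral_bilin_stdGaussian [CompleteSpace F] {ι : Type*} [Fintype ι] [DecidableEq ι]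
    (B : EuclideanSpace ℝ ι →L[ℝ] EuclideanSpace ℝ ι →L[ℝ] F) :
    ∫ y, B y y ∂(stdGaussian (EuclideanSpace ℝ ι))
      = ∑ k, B (EuclideanSpace.single k 1) (EuclideanSpace.single k 1) := by
  simp only [fun y => B.apply_eq_sum_single y y]
  rw [integral_finsetSum _ fun k _ => integrable_finsetSum _ fun l _ =>
    (integrable_mul_stdGaussian k l).smul_const _]
  refine Finset.sum_congr rfl fun k _ => ?_
  rw [integral_finsetSum _ fun l _ => (integrable_mul_stdGaussian k l).smul_const _]
  simp [integral_smul_const, integral_mul_stdGaussian]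

variable {n : ℕ}

lemma mixCoord_apply (i j k : Fin n) (x : EuclideanSpace ℝ (Fin n)) :
    mixCoord i j x k = if k = i then (x i + x j) / √2 else x k := by
  simp [mixCoord, Function.update_apply]

/-- `mixCoord i j` as a linear automorphism. -/
noncomputable def mixCoordEquiv (i j : Fin n) :
    EuclideanSpace ℝ (Fin n) ≃L[ℝ] EuclideanSpace ℝ (Fin n) :=
  (LinearEquiv.ofInjectiveEndo
    { toFun := mixCoord i j
      map_add' := fun x y => by
        ext k
        simp only [mixCoord_apply, PiLp.add_apply]
        split_ifs <;> ring
      map_smul' := fun c x => by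
        ext k
        simp only [mixCoord_apply, PiLp.smul_apply, smul_eq_mul, RingHom.id_apply]
        split_ifs <;> ring }
    ((injective_iff_map_eq_zero _).2 fun x hx => by
      have hx' : ∀ k, mixCoord i j x k = 0 := fun k => by
        have : mixCoord i j x = 0 := hx
        rw [this]; rfl
      simp only [mixCoord_apply] at hx'
      have hne : ∀ k, k ≠ i → x k = 0 := fun k hk => by simpa [hk] using hx' k
      have hi := hx' i
      rw [if_pos rfl, div_eq_zero_iff, or_iff_left (by positivity)] at hi
      have hi' : x i = 0 := by
        by_cases hij : j = i
        · rw [hij] at hi; linarith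
        · rw [hne j hij] at hi; linarith
      ext k
      by_cases hk : k = i
      · rw [hk, hi']; rfl
      · exact hne k hk)).toContinuousLinearEquiv

lemma mixCoord_single (i j k : Fin n) :
    mixCoord i j (EuclideanSpace.single k 1) = EuclideanSpace.single k 1
      + (((if k = i then 1 else 0) + (if k = j then 1 else 0)) / √2 - (if k = i then 1 else 0)) •
        EuclideanSpace.single i (1 : ℝ) := by
  ext l
  by_cases hl : l = i
  · subst hl
    simp [mixCoord_apply, eq_comm]
  · simp [mixCoord_apply, hl]

lemma sum_mixCoord_self (B : EuclideanSpace ℝ (Fin n) →L[ℝ] EuclideanSpace ℝ (Fin n) →L[ℝ] F)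
    (i : Fin n) :
    ∑ k, B (mixCoord i i (EuclideanSpace.single k 1)) (mixCoord i i (EuclideanSpace.single k 1))
      = ∑ k, B (EuclideanSpace.single k 1) (EuclideanSpace.single k 1)
        + B (EuclideanSpace.single i 1) (EuclideanSpace.single i 1) := by
  have h2 : √2 * √2 = 2 := Real.mul_self_sqrt (by norm_num)
  have hk : ∀ k, B (mixCoord i i (EuclideanSpace.single k 1))
      (mixCoord i i (EuclideanSpace.single k 1))
      = B (EuclideanSpace.single k 1) (EuclideanSpace.single k 1) +
        if k = i then B (EuclideanSpace.single i 1) (EuclideanSpace.single i 1) else 0 := by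
    intro k
    rw [mixCoord_single]
    by_cases h : k = i
    · subst h
      have h3 : ((1 : ℝ) + 1) / √2 - 1 = √2 - 1 := by
        rw [one_add_one_eq_two, Real.div_sqrt]
      simp only [if_true, h3, map_add, map_smul, _root_.add_apply, _root_.smul_apply]
      match_scalars
      linarith
    · simp [h]
  simp only [hk, Finset.sum_add_distrib, Finset.sum_ite_eq', Finset.mem_univ, if_true]

/-- Here `eᵢ ↦ eᵢ/√2` and `eⱼ ↦ eⱼ + eᵢ/√2`: the two halves of `B eᵢ eᵢ` restore the trace, leaving
only the cross terms. -/
lemma sum_mixCoord_of_ne (B : EuclideanSpace ℝ (Fin n) →L[ℝ] EuclideanSpace ℝ (Fin n) →L[ℝ] F)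
    {i j : Fin n} (hij : i ≠ j) :
    ∑ k, B (mixCoord i j (EuclideanSpace.single k 1)) (mixCoord i j (EuclideanSpace.single k 1))
      = ∑ k, B (EuclideanSpace.single k 1) (EuclideanSpace.single k 1)
        + (√2)⁻¹ • (B (EuclideanSpace.single i 1) (EuclideanSpace.single j 1)
          + B (EuclideanSpace.single j 1) (EuclideanSpace.single i 1)) := by
  have h2 : (√2)⁻¹ * (√2)⁻¹ = 1 / 2 := by
    rw [← mul_inv, Real.mul_self_sqrt (by norm_num)]; norm_num
  have hk : ∀ k, B (mixCoord i j (EuclideanSpace.single k 1))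
      (mixCoord i j (EuclideanSpace.single k 1))
      = B (EuclideanSpace.single k 1) (EuclideanSpace.single k 1) +
        ((if k = i then -((1 / 2 : ℝ) • B (EuclideanSpace.single i 1) (EuclideanSpace.single i 1))
          else 0) +
        if k = j then (1 / 2 : ℝ) • B (EuclideanSpace.single i 1) (EuclideanSpace.single i 1) +
          (√2)⁻¹ • (B (EuclideanSpace.single i 1) (EuclideanSpace.single j 1)
          + B (EuclideanSpace.single j 1) (EuclideanSpace.single i 1)) else 0) := by
    intro k
    rw [mixCoord_single]
    by_cases h : k = i
    · subst h
      simp only [if_true, if_neg hij, map_add, map_smul, _root_.add_apply, _root_.smul_apply,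
        add_zero, one_div]
      match_scalars
      linarith
    · by_cases h' : k = j
      · subst h'
        simp only [if_true, if_neg h, map_add, map_smul, _root_.add_apply, _root_.smul_apply,
          zero_add, one_div, sub_zero]
        match_scalars <;> linarith
      · simp [h, h']
  simp only [hk, Finset.sum_add_distrib, Finset.sum_ite_eq', Finset.mem_univ, if_true]
  module

lemma eq_zero_of_sum_mixCoord_eq_zero
    (B : EuclideanSpace ℝ (Fin n) →L[ℝ] EuclideanSpace ℝ (Fin n) →L[ℝ] F)
    (hsymm : ∀ x y, B x y = B y x)
    (hB : ∀ i j : Fin n, i ≤ j → ∑ k, B (mixCoord i j (EuclideanSpace.single k 1))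
      (mixCoord i j (EuclideanSpace.single k 1)) = 0) : B = 0 := by
  set T := ∑ k, B (EuclideanSpace.single k 1) (EuclideanSpace.single k 1) with hT
  have hdiag : ∀ i, T + B (EuclideanSpace.single i 1) (EuclideanSpace.single i 1) = 0 := fun i => by
    rw [hT, ← sum_mixCoord_self, hB i i le_rfl]
  have hT0 : T = 0 := by
    -- The sum over `i` equals `(n + 1) • T`.
    have h : ∑ i : Fin n, (T + B (EuclideanSpace.single i 1) (EuclideanSpace.single i 1)) = 0 :=
      Finset.sum_eq_zero fun i _ => hdiag i
    rw [Finset.sum_add_distrib, ← hT, Finset.sum_const, Finset.card_univ, Fintype.card_fin,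
      ← succ_nsmul, ← Nat.cast_smul_eq_nsmul ℝ] at h
    exact (smul_eq_zero.1 h).resolve_left (by positivity)
  have hlt : ∀ i j : Fin n, i < j →
      B (EuclideanSpace.single i 1) (EuclideanSpace.single j 1) = 0 := fun i j hij => by
    have h := sum_mixCoord_of_ne B hij.ne
    rw [hB i j hij.le, ← hT, hT0, zero_add, hsymm (EuclideanSpace.single j 1), ← two_smul ℝ,
      smul_smul] at h
    exact (smul_eq_zero.1 h.symm).resolve_left (by positivity)
  have hall : ∀ i j : Fin n,
      B (EuclideanSpace.single i 1) (EuclideanSpace.single j 1) = 0 := fun i j => by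
    rcases lt_trichotomy i j with h | rfl | h
    · exact hlt i j h
    · simpa [hT0] using hdiag i
    · rw [hsymm]; exact hlt j i h
  ext x y
  rw [B.apply_eq_sum_single]
  simp [hall]

end BilinearForms

/-! ### Zero Hessian and limits of affine maps. -/

section AffineLimit

open Filter Topology

variable {E F : Type*} [NormedAddCommGroup E] [NormedSpace ℝ E] [NormedAddCommGroup F]
  [NormedSpace ℝ F]

lemma exists_affineMap_of_hessian_eq_zero {u : E → F} (hu : ContDiff ℝ 2 u)
    (h : ∀ x, fderiv ℝ (fderiv ℝ u) x = 0) : ∃ g : E →ᵃ[ℝ] F, u = g := by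
  have hd : Differentiable ℝ (fderiv ℝ u) :=
    (hu.fderiv_right (m := 1) (by norm_num)).differentiable one_ne_zero
  have hconst : ∀ x, fderiv ℝ u x = fderiv ℝ u 0 := fun x =>
    is_const_of_fderiv_eq_zero hd h x 0
  have hud := hu.differentiable two_ne_zero
  have hconst2 : ∀ x, u x - fderiv ℝ u 0 x = u 0 - fderiv ℝ u 0 0 := fun x => by
    refine is_const_of_fderiv_eq_zero (𝕜 := ℝ) (f := fun x => u x - fderiv ℝ u 0 x)
      (hud.sub (fderiv ℝ u 0).differentiable) (fun y => ?_) x 0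
    rw [fderiv_fun_sub (hud y) (fderiv ℝ u 0).differentiableAt, ContinuousLinearMap.fderiv,
      hconst, sub_self]
  refine ⟨(fderiv ℝ u 0 : E →ₗ[ℝ] F).toAffineMap + AffineMap.const ℝ E (u 0), ?_⟩
  ext x
  have := hconst2 x
  rw [map_zero, sub_zero, sub_eq_iff_eq_add'] at this
  simpa using this

lemma exists_affineMap_of_tendsto {g : ℕ → E →ᵃ[ℝ] F} {f : E → F}
    (h : ∀ x, Tendsto (fun k => g k x) atTop (𝓝 (f x))) : ∃ g' : E →ᵃ[ℝ] F, f = g' := by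
  have hlin : Tendsto (fun k x => (g k).linear x) atTop (𝓝 fun x => f x - f 0) := by
    refine tendsto_pi_nhds.2 fun x => ((h x).sub (h 0)).congr fun k => ?_
    rw [(g k).decomp']
    simp
  refine ⟨(linearMapOfTendsto _ (fun k => (g k).linear) hlin).toAffineMap
    + AffineMap.const ℝ E (f 0), ?_⟩
  ext x
  simp

/-- Any `x` is the midpoint of some `x - y` and `x + y` at which convergence holds, since almost
every `y` works; affinity then forces convergence at `x` itself. -/
lemma exists_affineMap_ae_eq_of_ae_tendsto [FiniteDimensional ℝ E] [MeasurableSpace E]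
    [BorelSpace E] (μ : Measure E) [μ.IsAddHaarMeasure]
    {g : ℕ → E →ᵃ[ℝ] F} {f : E → F}
    (h : ∀ᵐ x ∂μ, Tendsto (fun k => g k x) atTop (𝓝 (f x))) :
    ∃ g' : E →ᵃ[ℝ] F, f =ᵐ[μ] g' := by
  have hex : ∀ x, ∃ c, Tendsto (fun k => g k x) atTop (𝓝 c) := by
    intro x
    have hq : ∀ᵐ y ∂μ, Tendsto (fun k => g k (x - y)) atTop (𝓝 (f (x - y))) :=
      (quasiMeasurePreserving_sub_left_of_right_invariant μ x).ae h
    have hq' : ∀ᵐ y ∂μ, Tendsto (fun k => g k (x + y)) atTop (𝓝 (f (x + y))) :=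
      (quasiMeasurePreserving_add_left μ x).ae h
    obtain ⟨y, hy, hy'⟩ := (hq.and hq').exists
    refine ⟨(2 : ℝ)⁻¹ • (f (x - y) + f (x + y)), ((hy.add hy').const_smul _).congr fun k => ?_⟩
    rw [(g k).decomp]
    simp only [Pi.add_apply, map_sub, map_add]
    module
  choose f' hf' using hex
  obtain ⟨g', hg'⟩ := exists_affineMap_of_tendsto hf'
  refine ⟨g', ?_⟩
  filter_upwards [h] with x hx
  rw [← hg']
  exact tendsto_nhds_unique hx (hf' x)

end AffineLimit

/-! ### Assembly of the proof. -/

section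

open Filter Topology

/-- A function invariant under the Gaussian averages associated with all the maps `mixCoord i j`
agrees almost everywhere with an affine map. -/
lemma exists_affineMap_ae_eq_of_integral_mixCoord {F : Type*} [NormedAddCommGroup F]
    [NormedSpace ℝ F] [CompleteSpace F] {n : ℕ} {f : EuclideanSpace ℝ (Fin n) → F}
    (hfm : StronglyMeasurable f)
    (hf : ∀ c : ℝ, 0 < c → Integrable fun x => Real.exp (-c * ‖x‖ ^ 2) • f x)
    (hA : ∀ i j : Fin n, i ≤ j → ∀ h : ℝ, 0 < h →
      ∀ᵐ x, ∫ y, f (x + √h • mixCoordEquiv i j y) ∂(stdGaussian (EuclideanSpace ℝ (Fin n))) = f x) :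
    ∃ g : EuclideanSpace ℝ (Fin n) →ᵃ[ℝ] F, f =ᵐ[volume] g := by
  have hloc := locallyIntegrable_of_exp_neg_smul hfm one_pos (hf 1 one_pos)
  -- The fixed ratio `2` of outer to inner radius is the bounded eccentricity required for almost
  -- everywhere convergence of the mollifications.
  let φ : ℕ → ContDiffBump (0 : EuclideanSpace ℝ (Fin n)) := fun k =>
    { rIn := 1 / ((k : ℝ) + 1)
      rOut := 2 * (1 / ((k : ℝ) + 1))
      rIn_pos := by positivity
      rIn_lt_rOut := by
        have : 0 < 1 / ((k : ℝ) + 1) := by positivity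
        linarith }
  have hlim := ContDiffBump.ae_convolution_tendsto_right_of_locallyIntegrable
    (μ := (volume : Measure (EuclideanSpace ℝ (Fin n)))) (φ := φ) (l := atTop) (K := 2)
    (by simpa [φ] using (tendsto_one_div_add_atTop_nhds_zero_nat (𝕜 := ℝ)).const_mul 2)
    (Eventually.of_forall fun k => le_rfl) hloc
  have haff : ∀ k, ∃ g : EuclideanSpace ℝ (Fin n) →ᵃ[ℝ] F,
      convolution ((φ k).normed volume) f (ContinuousLinearMap.lsmul ℝ ℝ) volume = g := by
    intro k
    have hd : ContDiff ℝ 2 ((φ k).normed volume) := (φ k).contDiff_normed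
    have hs : HasCompactSupport ((φ k).normed volume) := (φ k).hasCompactSupport_normed
    have hu : ContDiff ℝ 2
        (convolution ((φ k).normed volume) f (ContinuousLinearMap.lsmul ℝ ℝ) volume) :=
      hs.contDiff_convolution_left (n := 2) (ContinuousLinearMap.lsmul ℝ ℝ) hd hloc
    refine exists_affineMap_of_hessian_eq_zero hu fun x => ?_
    refine eq_zero_of_sum_mixCoord_eq_zero _ (fun y z => ?_) fun i j hij => ?_
    · exact (hu.contDiffAt.isSymmSndFDerivAt (by simp)) y z
    · have h := integral_hessian_convolution_eq_zero hfm hf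
        (mixCoordEquiv i j : EuclideanSpace ℝ (Fin n) →L[ℝ] EuclideanSpace ℝ (Fin n))
        (hA i j hij) hs hd x
      set B := fderiv ℝ (fderiv ℝ
        (convolution ((φ k).normed volume) f (ContinuousLinearMap.lsmul ℝ ℝ) volume)) x
      exact (integral_bilin_stdGaussian (B.bilinearComp
        (mixCoordEquiv i j : EuclideanSpace ℝ (Fin n) →L[ℝ] EuclideanSpace ℝ (Fin n))
        (mixCoordEquiv i j : EuclideanSpace ℝ (Fin n) →L[ℝ] EuclideanSpace ℝ (Fin n)))).symm.trans h
  choose g hg using haff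
  exact exists_affineMap_ae_eq_of_ae_tendsto volume (g := g) (by simpa only [hg] using hlim)

end

theorem theorem2 {Ω : Type*} [mΩ : MeasurableSpace Ω] (P : Measure Ω) [IsProbabilityMeasure P]
    (n m : ℕ) (ℱ : Filtration ℝ≥0 mΩ)
    (W : ℝ≥0 → Ω → EuclideanSpace ℝ (Fin n))
    (hW : IsStandardBrownianMotion W P) (hWℱ : StronglyAdapted ℱ W)
    (f : EuclideanSpace ℝ (Fin n) → EuclideanSpace ℝ (Fin m))
    (hf : AEMeasurable f volume)
    (hmart : ∀ i j : Fin n, i ≤ j → Martingale (fun t ω => f (mixCoord i j (W t ω))) ℱ P) :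
    ∃ g : EuclideanSpace ℝ (Fin n) →ᵃ[ℝ] EuclideanSpace ℝ (Fin m), f =ᵐ[volume] g := by
  -- For `n = 0` there is no index pair and hence no martingale, but the space is a point. For `n >
  -- 0` the pair `(0, 0)` already supplies the integrability.
  rcases Nat.eq_zero_or_pos n with rfl | hn
  · refine ⟨AffineMap.const ℝ _ (f 0), ae_of_all _ fun x => ?_⟩
    rw [Subsingleton.elim x 0, AffineMap.const_apply]
  have hfg := hf.ae_eq_mk
  have hg : StronglyMeasurable (hf.mk f) := hf.measurable_mk.stronglyMeasurable
  obtain ⟨a, ha⟩ := exists_affineMap_ae_eq_of_integral_mixCoord hg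
    (fun c hc => hW.integrable_exp_neg_smul_of_martingale (mixCoordEquiv ⟨0, hn⟩ ⟨0, hn⟩) hfg hg
      (hmart _ _ le_rfl) hc)
    (fun i j hij h hh => hW.ae_eq_integral_of_martingale hWℱ (mixCoordEquiv i j) hfg hg
      (hmart i j hij) hh)
  exact ⟨a, hfg.trans ha⟩
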